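/- Let $G$ and $H$ be connected cubic (that is, 3-regular) finite simple graphs, with chromatic numbers $\chi(G)$ and $\chi(H)$. Then: 1. $\chi(G)\le 4$; moreover $\chi(G)=4$ if and only if $G$ is isomorphic to the complete graph $K_4$, and $\chi(G)=2$ if and only if $G$ is bipartite. 2. If $G$ and $H$ are cospectral, that is, if their adjacency matrices have the same eigenvalues with the same multiplicities, then $\chi(G)=\chi(H)$; moreover $G$ is bipartite if and only if $H$ is bipartite, and $G\cong K_4$ if and only if $H\cong K_4$. In particular, the chromatic number of a connected cubic graph is determined by its adjacency spectrum. -/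

import Mathlib

/-- The adjacency spectrum of a finite graph: the multiset of the eigenvalues of its real adjacency
matrix, each eigenvalue being repeated according to its multiplicity. -/
noncomputable def SimpleGraph.adjSpectrum {V : Type*} [Fintype V] [DecidableEq V]
    (G : SimpleGraph V) [DecidableRel G.Adj] : Multiset ℝ :=
  Finset.univ.val.map (SimpleGraph.isHermitian_adjMatrix ℝ G).eigenvalues

/-- Two finite graphs (on possibly different vertex sets) are cospectral if their adjacency spectra
agree, multiplicities included. -/
def SimpleGraph.Cospectral {V W : Type*} [Fintype V] [DecidableEq V] [Fintype W] [DecidableEq W]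
    (G : SimpleGraph V) [DecidableRel G.Adj] (H : SimpleGraph W) [DecidableRel H.Adj] : Prop :=
  G.adjSpectrum = H.adjSpectrum

/-! The chromatic number is 4, 2 or 3 according as the graph has four vertices, is bipartite, or
neither, and the spectrum sees both conditions. Its size is the number of vertices, and a connected
cubic graph has four vertices exactly when it is `K₄`. It contains `-3` exactly when the graph is
bipartite (`Connected.isBipartite_iff_neg_mem_adjSpectrum`), by a maximum principle for
eigenvectors. The bound 3 outside `K₄` is Brooks' theorem: a path `x, v, y` with `x`, `y`
nonadjacent is prolonged until stuck. Either it is Hamiltonian, or its end closes a cycle joined to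
the rest of the graph. In both cases a greedy colouring ends at a vertex with two neighbours of
equal colour. -/

namespace SimpleGraph

/-! ### Greedy colouring -/

/-- The map `c` is a proper colouring of the subgraph of `G` induced by `S`. -/
def ProperOn {V α : Type*} (G : SimpleGraph V) (c : V → α) (S : Finset V) : Prop :=
  ∀ u ∈ S, ∀ v ∈ S, G.Adj u v → c u ≠ c v

theorem ProperOn.exists_insert {V : Type*} [Fintype V] [DecidableEq V] {G : SimpleGraph V}
    [DecidableRel G.Adj] {d : ℕ} {c : V → Fin d} {S : Finset V} (hc : G.ProperOn c S) {v : V}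
    (hv : v ∉ S) (hcard : ((G.neighborFinset v ∩ S).image c).card < d) :
    ∃ c' : V → Fin d, G.ProperOn c' (insert v S) ∧ ∀ u ∈ S, c' u = c u := by
  obtain ⟨a, ha⟩ : ∃ a : Fin d, a ∉ (G.neighborFinset v ∩ S).image c := by
    by_contra! h
    have h2 := Finset.card_le_card (fun a _ => h a : (Finset.univ : Finset (Fin d)) ⊆ _)
    simp at h2
    omega
  have ha' : ∀ w ∈ S, G.Adj v w → c w ≠ a := by
    intro w hw hvw h
    exact ha (Finset.mem_image.2 ⟨w, by simp [hvw, hw], h⟩)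
  have hne : ∀ u ∈ S, u ≠ v := fun u hu h => hv (h ▸ hu)
  refine ⟨Function.update c v a, ?_, fun u hu => Function.update_of_ne (hne u hu) _ _⟩
  intro x hx y hy hxy
  rw [Finset.mem_insert] at hx hy
  rcases hx with rfl | hx <;> rcases hy with rfl | hy
  · exact absurd hxy G.irrefl
  · rw [Function.update_self, Function.update_of_ne (hne y hy)]
    exact (ha' y hy hxy).symm
  · rw [Function.update_self, Function.update_of_ne (hne x hx)]
    exact ha' x hx hxy.symm
  · rw [Function.update_of_ne (hne x hx), Function.update_of_ne (hne y hy)]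
    exact hc x hx y hy hxy

/-- Greedy colouring: a colouring with `d` colours extends from `S` to `S ∪ T` when every nonempty
subset `U` of `T` has a vertex with a neighbour outside `S ∪ U`. -/
theorem ProperOn.exists_union {V : Type*} [Fintype V] [DecidableEq V] {G : SimpleGraph V}
    [DecidableRel G.Adj] {d : ℕ} (hd : ∀ v, G.degree v ≤ d) {c : V → Fin d} {S : Finset V}
    (hc : G.ProperOn c S) (T : Finset V) (hST : Disjoint S T)
    (hT : ∀ U ⊆ T, U.Nonempty → ∃ v ∈ U, ∃ w, G.Adj v w ∧ w ∉ S ∧ w ∉ U) :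
    ∃ c' : V → Fin d, G.ProperOn c' (S ∪ T) ∧ ∀ u ∈ S, c' u = c u := by
  induction hn : T.card generalizing T with
  | zero =>
    obtain rfl := Finset.card_eq_zero.1 hn
    exact ⟨c, by simpa using hc, fun _ _ => rfl⟩
  | succ n ih =>
    -- `v` is coloured last; its neighbour `w` is still uncoloured then, so at most `d - 1`
    -- neighbours constrain `v`.
    obtain ⟨v, hv, w, hvw, hwS, hwT⟩ := hT T subset_rfl (Finset.card_pos.1 (by omega))
    obtain ⟨c₁, hc₁, h₁⟩ := ih (T.erase v) (hST.mono_right (T.erase_subset v))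
      (fun U hU => hT U (hU.trans (T.erase_subset v))) (by rw [Finset.card_erase_of_mem hv]; omega)
    have hvS : v ∉ S := fun h => Finset.disjoint_left.1 hST h hv
    obtain ⟨c₂, hc₂, h₂⟩ := hc₁.exists_insert (v := v) (by simp [hvS]) (by
      refine Finset.card_image_le.trans_lt (lt_of_lt_of_le (Finset.card_lt_card ?_) (hd v))
      refine Finset.ssubset_iff_subset_ne.2 ⟨Finset.inter_subset_left, fun h => ?_⟩
      have : w ∈ G.neighborFinset v := by simpa using hvw
      rw [← h] at this
      simp [hwS, hwT] at this)
    refine ⟨c₂, ?_, fun u hu => (h₂ u (by simp [hu])).trans (h₁ u hu)⟩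
    convert hc₂ using 1
    rw [← Finset.union_insert, Finset.insert_erase hv]

/-- A colouring of `S` in which `r` sees two neighbours of the same colour extends to all of `G` if
the vertices other than `r` can be coloured greedily. -/
theorem ProperOn.colorable {V : Type*} [Fintype V] [DecidableEq V] {G : SimpleGraph V}
    [DecidableRel G.Adj] {d : ℕ} (hd : ∀ v, G.degree v ≤ d) {c : V → Fin d} {S : Finset V}
    (hc : G.ProperOn c S) {r a b : V} (hr : r ∉ S) (ha : a ∈ S) (hb : b ∈ S) (hab : a ≠ b)
    (hra : G.Adj r a) (hrb : G.Adj r b) (hcab : c a = c b)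
    (hT : ∀ U : Finset V, Disjoint S U → r ∉ U → U.Nonempty →
      ∃ v ∈ U, ∃ w, G.Adj v w ∧ w ∉ S ∧ w ∉ U) :
    G.Colorable d := by
  obtain ⟨c₁, hc₁, h₁⟩ := hc.exists_union hd (Sᶜ.erase r)
    (Finset.disjoint_left.2 fun x hx => by simp [hx]) (fun U hU hne => hT U
      (Finset.disjoint_left.2 fun x hx hxU => by simpa [hx] using hU hxU)
      (fun h => by simpa using hU h) hne)
  obtain ⟨c₂, hc₂, -⟩ := hc₁.exists_insert (v := r) (by simp [hr]) (by
    -- Since `a` and `b` share a colour, dropping `a` loses none: at most `d - 1` colours are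
    -- forbidden at `r`.
    have hsub : (G.neighborFinset r ∩ (S ∪ Sᶜ.erase r)).image c₁ ⊆
        ((G.neighborFinset r).erase a).image c₁ := by
      intro z hz
      obtain ⟨x, hx, rfl⟩ := Finset.mem_image.1 hz
      by_cases hxa : x = a
      · subst hxa
        exact Finset.mem_image.2 ⟨b, by simp [hab.symm, hrb], by rw [h₁ b hb, h₁ x ha, hcab]⟩
      · exact Finset.mem_image_of_mem _ (Finset.mem_erase.2 ⟨hxa, (Finset.mem_inter.1 hx).1⟩)
    refine (Finset.card_le_card hsub).trans_lt (Finset.card_image_le.trans_lt ?_)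
    exact lt_of_lt_of_le (Finset.card_erase_lt_of_mem (by simpa using hra)) (hd r))
  refine ⟨Coloring.mk c₂ fun {u v} huv => hc₂ u ?_ v ?_ huv⟩ <;>
    simp [or_iff_not_imp_left] <;> tauto

/-! ### Boundary edges, maximal paths and Brooks' theorem -/

theorem Connected.exists_adj_boundary {V : Type*} {G : SimpleGraph V} (hG : G.Connected)
    {U : Set V} {u w : V} (hu : u ∈ U) (hw : w ∉ U) : ∃ x ∈ U, ∃ y, G.Adj x y ∧ y ∉ U := by
  obtain ⟨p⟩ := hG.preconnected u w
  obtain ⟨d, -, h1, h2⟩ := p.exists_boundary_dart U hu hw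
  exact ⟨d.fst, h1, d.snd, d.adj, h2⟩

/-- The vertices `f 0, …, f n` form a path of `G`. -/
structure IsPathSeq {V : Type*} (G : SimpleGraph V) (f : ℕ → V) (n : ℕ) : Prop where
  inj : ∀ i ≤ n, ∀ j ≤ n, f i = f j → i = j
  adj : ∀ i < n, G.Adj (f i) (f (i + 1))

/-- A path of `G` with two given first edges that cannot be prolonged. -/
theorem exists_maximal_isPathSeq {V : Type*} [Fintype V] [DecidableEq V] {G : SimpleGraph V}
    {x v y : V} (hvx : G.Adj v x) (hvy : G.Adj v y) (hxy : x ≠ y) :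
    ∃ (f : ℕ → V) (n : ℕ), 2 ≤ n ∧ f 0 = x ∧ f 1 = v ∧ f 2 = y ∧ G.IsPathSeq f n ∧
      ∀ w, G.Adj (f n) w → ∃ i ≤ n, f i = w := by
  let P : ℕ → Prop := fun n => ∃ f : ℕ → V, f 0 = x ∧ f 1 = v ∧ f 2 = y ∧ G.IsPathSeq f n
  have h2 : P 2 := by
    refine ⟨fun i => if i = 0 then x else if i = 1 then v else y, rfl, rfl, rfl, ?_, ?_⟩
    · have h1 := hvx.ne
      have h2 := hvy.ne
      intro i hi j hj
      interval_cases i <;> interval_cases j <;> simp [h1, h2, hxy, h1.symm, h2.symm, hxy.symm]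
    · intro i hi
      interval_cases i
      · exact hvx.symm
      · exact hvy
  have hbound : ∀ n, P n → n ≤ Fintype.card V := by
    rintro n ⟨f, -, -, -, hf⟩
    have := Finset.card_le_card_of_injOn (s := Finset.range (n + 1)) (t := Finset.univ) f
      (fun _ _ => Finset.mem_univ _) (fun i hi j hj h => hf.inj i
        (by simpa [Nat.lt_succ_iff] using hi) j (by simpa [Nat.lt_succ_iff] using hj) h)
    rw [Finset.card_range, Finset.card_univ] at this
    omega
  classical
  set n := Nat.findGreatest P (Fintype.card V) with hn
  obtain ⟨f, h0, h1, hf2, hf⟩ : P n := Nat.findGreatest_spec (hbound 2 h2) h2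
  have hn2 : 2 ≤ n := Nat.le_findGreatest (hbound 2 h2) h2
  refine ⟨f, n, hn2, h0, h1, hf2, hf, fun w hw => ?_⟩
  by_contra! hne
  have hP : P (n + 1) := by
    refine ⟨Function.update f (n + 1) w, ?_, ?_, ?_, ?_, ?_⟩
    · rw [Function.update_of_ne (by omega), h0]
    · rw [Function.update_of_ne (by omega), h1]
    · rw [Function.update_of_ne (by omega), hf2]
    · intro i hi j hj hij
      by_cases hi' : i = n + 1 <;> by_cases hj' : j = n + 1
      · omega
      · subst hi'
        rw [Function.update_self, Function.update_of_ne hj'] at hij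
        exact absurd hij.symm (hne j (by omega))
      · subst hj'
        rw [Function.update_self, Function.update_of_ne hi'] at hij
        exact absurd hij (hne i (by omega))
      · rw [Function.update_of_ne hi', Function.update_of_ne hj'] at hij
        exact hf.inj i (by omega) j (by omega) hij
    · intro i hi
      rw [Function.update_of_ne (by omega)]
      by_cases hin : i = n
      · subst hin
        rwa [Function.update_self]
      · rw [Function.update_of_ne (by omega)]
        exact hf.adj i (by omega)
  have := Nat.le_findGreatest (hbound _ hP) hP
  omega

/-- Brooks' theorem when a Hamiltonian path starts with two nonadjacent neighbours of its second
vertex. -/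
theorem IsPathSeq.colorable_of_surjective {V : Type*} [Fintype V] [DecidableEq V]
    {G : SimpleGraph V} [DecidableRel G.Adj] {d : ℕ} (hd : 3 ≤ d) (hG : G.IsRegularOfDegree d)
    {f : ℕ → V} {n : ℕ} (hf : G.IsPathSeq f n) (hn : 2 ≤ n) (h02 : ¬ G.Adj (f 0) (f 2))
    (hsurj : ∀ v, ∃ i ≤ n, f i = v) : G.Colorable d := by
  -- As `d ≥ 3`, `f 1` has a neighbour besides `f 0` and `f 2`; it lies further along the
  -- Hamiltonian path.
  obtain ⟨j, hj3, hjn, hj⟩ : ∃ j, 3 ≤ j ∧ j ≤ n ∧ G.Adj (f 1) (f j) := by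
    obtain ⟨w, hw, hw'⟩ : ∃ w ∈ G.neighborFinset (f 1), w ∉ ({f 0, f 2} : Finset V) := by
      refine Finset.exists_mem_notMem_of_card_lt_card (Finset.card_le_two.trans_lt ?_)
      rw [card_neighborFinset_eq_degree, hG (f 1)]
      omega
    obtain ⟨j, hjn, rfl⟩ := hsurj w
    rw [mem_neighborFinset] at hw
    refine ⟨j, ?_, hjn, hw⟩
    by_contra! hlt
    interval_cases j
    · simp at hw'
    · exact G.irrefl hw
    · simp at hw'
  have hne : ∀ i ≤ n, i ≠ 0 → i ≠ 2 → f i ∉ ({f 0, f 2} : Finset V) := by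
    intro i hi h0 h2 h
    rcases Finset.mem_insert.1 h with h | h
    · exact h0 (hf.inj _ hi _ (by omega) h)
    · exact h2 (hf.inj _ hi _ (by omega) (Finset.mem_singleton.1 h))
  have hc : G.ProperOn (fun _ => (⟨0, by omega⟩ : Fin d)) {f 0, f 2} := by
    intro u hu v hv huv
    simp only [Finset.mem_insert, Finset.mem_singleton] at hu hv
    rcases hu with rfl | rfl <;> rcases hv with rfl | rfl
    · exact absurd huv G.irrefl
    · exact absurd huv h02
    · exact absurd huv.symm h02
    · exact absurd huv G.irrefl
  refine hc.colorable (fun v => (hG v).le) (r := f 1) (a := f 0) (b := f 2)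
    (hne 1 (by omega) (by omega) (by omega)) (by simp) (by simp)
    (fun h => by simpa using hf.inj _ (by omega) _ (by omega) h)
    (hf.adj 0 (by omega)).symm (hf.adj 1 (by omega)) rfl ?_
  intro U hSU hrU ⟨u, hu⟩
  have h3 : ∀ i, f i ∈ U → 3 ≤ i := by
    intro i hi
    by_contra! hlt
    interval_cases i
    · exact Finset.disjoint_left.1 hSU (by simp) hi
    · exact hrU hi
    · exact Finset.disjoint_left.1 hSU (by simp) hi
  classical
  -- The implied colouring order is `f n, …, f (j + 1)`, then `f 3, …, f j`, and finally `f 1`. Each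
  -- vertex before `f 1` has a later neighbour: its predecessor on the path in the first run, its
  -- successor in the second, and `f 1` for `f j`.
  by_cases hlow : ∃ i, i ≤ j ∧ f i ∈ U
  · obtain ⟨i₀, hi₀, hi₀U⟩ := hlow
    set i := Nat.findGreatest (fun i => f i ∈ U) j
    have hiU : f i ∈ U := Nat.findGreatest_spec (P := fun i => f i ∈ U) hi₀ hi₀U
    have hij : i ≤ j := Nat.findGreatest_le j
    have := h3 i hiU
    rcases hij.eq_or_lt with heq | hlt
    · exact ⟨f i, hiU, f 1, by rw [heq]; exact hj.symm, hne 1 (by omega) (by omega) (by omega), hrU⟩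
    · exact ⟨f i, hiU, f (i + 1), hf.adj i (by omega), hne _ (by omega) (by omega) (by omega),
        Nat.findGreatest_is_greatest (P := fun i => f i ∈ U) (Nat.lt_succ_self i) hlt⟩
  · push Not at hlow
    have hex : ∃ i, i ≤ n ∧ f i ∈ U := by
      obtain ⟨i, hi, rfl⟩ := hsurj u
      exact ⟨i, hi, hu⟩
    obtain ⟨hin, hiU⟩ := Nat.find_spec hex
    have hmin := fun m => Nat.find_min hex (m := m)
    set i := Nat.find hex
    have hji : j < i := by
      by_contra! h
      exact hlow i h hiU
    have hadj := hf.adj (i - 1) (by omega)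
    rw [Nat.sub_add_cancel (by omega)] at hadj
    exact ⟨f i, hiU, f (i - 1), hadj.symm, hne _ (by omega) (by omega) (by omega),
      fun h => hmin (i - 1) (by omega) ⟨by omega, h⟩⟩

/-- Brooks' theorem when some path that misses a vertex has an end all of whose neighbours lie on
the path. -/
theorem IsPathSeq.colorable_of_not_surjective {V : Type*} [Fintype V] [DecidableEq V]
    {G : SimpleGraph V} [DecidableRel G.Adj] (hconn : G.Connected) {d : ℕ} (hd : 2 ≤ d)
    (hG : G.IsRegularOfDegree d) {f : ℕ → V} {n : ℕ} (hf : G.IsPathSeq f n) (hn : 1 ≤ n)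
    (hend : ∀ w, G.Adj (f n) w → ∃ i ≤ n, f i = w) {z : V} (hz : ∀ i ≤ n, f i ≠ z) :
    G.Colorable d := by
  classical
  have hex : ∃ j, j ≤ n ∧ G.Adj (f n) (f j) := by
    refine ⟨n - 1, by omega, ?_⟩
    have := hf.adj (n - 1) (by omega)
    rw [Nat.sub_add_cancel hn] at this
    exact this.symm
  obtain ⟨hjn, hadj⟩ := Nat.find_spec hex
  have hmin := fun m => Nat.find_min hex (m := m)
  set j := Nat.find hex
  -- the cycle `f j, …, f n`
  set C : Finset V := (Finset.Icc j n).image f with hC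
  have hmem : ∀ i ≤ n, (f i ∈ C ↔ j ≤ i) := by
    intro i hi
    refine ⟨fun h => ?_, fun h => Finset.mem_image_of_mem _ (Finset.mem_Icc.2 ⟨h, hi⟩)⟩
    obtain ⟨k, hk, hki⟩ := Finset.mem_image.1 h
    rw [Finset.mem_Icc] at hk
    rw [← hf.inj k hk.2 i hi hki]
    exact hk.1
  have hCf : ∀ v ∈ C, ∃ i, j ≤ i ∧ i ≤ n ∧ f i = v := by
    intro v hv
    obtain ⟨k, hk, hki⟩ := Finset.mem_image.1 hv
    rw [Finset.mem_Icc] at hk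
    exact ⟨k, hk.1, hk.2, hki⟩
  have hzC : z ∉ C := fun h => by
    obtain ⟨i, -, hi, hiz⟩ := hCf z h
    exact hz i hi hiz
  have hnC : ∀ w, G.Adj (f n) w → w ∈ C := by
    intro w hw
    obtain ⟨i, hi, rfl⟩ := hend w hw
    rw [hmem i hi]
    by_contra! h
    exact hmin i h ⟨hi, hw⟩
  -- the last vertex `f l` of the cycle with a neighbour `u` off it
  let Q : ℕ → Prop := fun i => j ≤ i ∧ ∃ u, G.Adj (f i) u ∧ u ∉ C
  obtain ⟨i₀, hi₀n, hi₀⟩ : ∃ i ≤ n, Q i := by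
    obtain ⟨x, hx, y, hxy, hy⟩ := hconn.exists_adj_boundary (U := (C : Set V))
      (u := f n) (w := z) (by simpa using (hmem n le_rfl).2 hjn) (by simpa using hzC)
    obtain ⟨i, hji, hin, rfl⟩ := hCf x (by simpa using hx)
    exact ⟨i, hin, hji, y, hxy, by simpa using hy⟩
  set l := Nat.findGreatest Q n
  obtain ⟨hjl, u, hlu, huC⟩ : Q l := Nat.findGreatest_spec hi₀n hi₀
  have hln : l < n := by
    refine lt_of_le_of_ne (Nat.findGreatest_le n) fun h => huC (hnC u ?_)
    rw [← h]
    exact hlu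
  -- By the choice of `l`, `f (l + 1)` has no neighbour off the cycle, so it may copy any colour
  -- used there.
  have hl1 : ∀ w, G.Adj (f (l + 1)) w → w ∈ C := by
    intro w hw
    by_contra hwC
    exact Nat.findGreatest_is_greatest (P := Q) (Nat.lt_succ_self l) hln ⟨by omega, w, hw, hwC⟩
  -- colour the complement of the cycle, then give `f (l + 1)` the colour of `u`
  have hc₀ : G.ProperOn (fun _ => (⟨0, by omega⟩ : Fin d)) ∅ := by
    intro u hu
    simp at hu
  obtain ⟨c, hc, -⟩ := hc₀.exists_union (fun v => (hG v).le) Cᶜ (by simp) (by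
    -- Connectedness gives an edge leaving `U`, since `f n` lies on the cycle and hence outside `U`.
    rintro U hU ⟨x, hx⟩
    obtain ⟨a, ha, b, hab, hb⟩ := hconn.exists_adj_boundary (U := (U : Set V)) (u := x) (w := f n)
      (by simpa using hx)
      (fun h => Finset.mem_compl.1 (hU (by simpa using h)) ((hmem n le_rfl).2 hjn))
    exact ⟨a, by simpa using ha, b, hab, by simp, by simpa using hb⟩)
  rw [Finset.empty_union] at hc
  have hl1C : f (l + 1) ∈ C := (hmem _ hln).2 (by omega)
  have hlC : f l ∈ C := (hmem _ hln.le).2 hjl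
  have hne : ∀ x ∉ C, x ≠ f (l + 1) := fun x hx h => hx (h ▸ hl1C)
  have hlne : f l ≠ f (l + 1) := fun h => by
    have := hf.inj _ hln.le _ hln h
    omega
  have hc' : G.ProperOn (Function.update c (f (l + 1)) (c u)) (insert (f (l + 1)) Cᶜ) := by
    intro x hx y hy hxy
    simp only [Finset.mem_insert, Finset.mem_compl] at hx hy
    rcases hx with rfl | hx <;> rcases hy with rfl | hy
    · exact absurd hxy G.irrefl
    · exact absurd (hl1 y hxy) hy
    · exact absurd (hl1 x hxy.symm) hx
    · rw [Function.update_of_ne (hne x hx), Function.update_of_ne (hne y hy)]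
      exact hc x (by simpa using hx) y (by simpa using hy) hxy
  refine hc'.colorable (fun v => (hG v).le) (r := f l) (a := u) (b := f (l + 1))
    (by simp [hlne, hlC]) (by simp [huC]) (by simp) (hne u huC) hlu (hf.adj l hln)
    (by rw [Function.update_self, Function.update_of_ne (hne u huC)]) ?_
  intro U hSU hrU ⟨x, hx⟩
  have hUC : ∀ v ∈ U, v ∈ C := fun v hv => by
    by_contra h
    exact Finset.disjoint_left.1 hSU (by simp [h]) hv
  have hl1U : f (l + 1) ∉ U := fun h => Finset.disjoint_left.1 hSU (by simp) h
  have hS : ∀ i ≤ n, j ≤ i → i ≠ l + 1 → f i ∉ insert (f (l + 1)) Cᶜ := by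
    intro i hi hji hil h
    rcases Finset.mem_insert.1 h with h | h
    · exact hil (hf.inj _ hi _ hln h)
    · exact Finset.mem_compl.1 h ((hmem i hi).2 hji)
  -- The implied order runs round the cycle: `f (l + 2), …, f n, f j, …, f (l - 1)`, then `f l`.
  -- Each vertex before `f l` has its cyclic successor still uncoloured, and the edge from `f n` to
  -- `f j` closes the circuit.
  by_cases hlow : ∃ i, i ≤ l ∧ f i ∈ U
  · obtain ⟨i₀, hi₀, hi₀U⟩ := hlow
    set i := Nat.findGreatest (fun i => f i ∈ U) l
    have hiU : f i ∈ U := Nat.findGreatest_spec (P := fun i => f i ∈ U) hi₀ hi₀U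
    have hil : i ≤ l := Nat.findGreatest_le l
    have hil' : i ≠ l := fun h => hrU (h ▸ hiU)
    have hji := (hmem i (by omega)).1 (hUC _ hiU)
    exact ⟨f i, hiU, f (i + 1), hf.adj i (by omega), hS _ (by omega) (by omega) (by omega),
      Nat.findGreatest_is_greatest (P := fun i => f i ∈ U) (Nat.lt_succ_self i) (by omega)⟩
  · push Not at hlow
    obtain ⟨i₀, -, hi₀, rfl⟩ := hCf x (hUC x hx)
    set i := Nat.findGreatest (fun i => f i ∈ U) n
    have hiU : f i ∈ U := Nat.findGreatest_spec (P := fun i => f i ∈ U) hi₀ hx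
    have hin : i ≤ n := Nat.findGreatest_le n
    have hli : l < i := by
      by_contra! h
      exact hlow i h hiU
    have hli' : i ≠ l + 1 := fun h => hl1U (h ▸ hiU)
    rcases hin.eq_or_lt with heq | hlt
    · exact ⟨f i, hiU, f j, by rw [heq]; exact hadj, hS j (by omega) le_rfl (by omega),
        hlow j hjl⟩
    · exact ⟨f i, hiU, f (i + 1), hf.adj i hlt, hS _ (by omega) (by omega) (by omega),
        Nat.findGreatest_is_greatest (P := fun i => f i ∈ U) (Nat.lt_succ_self i) hlt⟩

/-- In a connected graph that is not complete, some vertex has two nonadjacent neighbours. -/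
theorem Connected.exists_nonadj_neighbors {V : Type*} {G : SimpleGraph V} (hG : G.Connected)
    (hne : G ≠ ⊤) : ∃ v x y, G.Adj v x ∧ G.Adj v y ∧ x ≠ y ∧ ¬ G.Adj x y := by
  by_contra! h
  -- If neighbours of a common vertex are always equal or adjacent, every walk shortcuts to a single
  -- edge.
  have key : ∀ {u w : V} (p : G.Walk u w), u ≠ w → G.Adj u w := by
    intro u w p
    induction p with
    | nil => intro h; exact absurd rfl h
    | @cons a b c hab p ih =>
      intro hac
      by_cases hbc : b = c
      · exact hbc ▸ hab
      · exact h b a c hab.symm (ih hbc) hac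
  refine hne (eq_top_iff_forall_ne_adj.2 fun u w huw => ?_)
  obtain ⟨p⟩ := hG.preconnected u w
  exact key p huw

/-- **Brooks' theorem** for connected regular graphs. -/
theorem Connected.colorable_of_isRegularOfDegree {V : Type*} [Fintype V] [DecidableEq V]
    {G : SimpleGraph V} [DecidableRel G.Adj] (hconn : G.Connected) {d : ℕ} (hd : 3 ≤ d)
    (hG : G.IsRegularOfDegree d) (hne : G ≠ ⊤) : G.Colorable d := by
  obtain ⟨v, x, y, hvx, hvy, hxy, hnxy⟩ := hconn.exists_nonadj_neighbors hne
  obtain ⟨f, n, hn, rfl, -, rfl, hf, hend⟩ := exists_maximal_isPathSeq hvx hvy hxy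
  by_cases hsurj : ∀ v, ∃ i ≤ n, f i = v
  · exact hf.colorable_of_surjective hd hG hn hnxy hsurj
  · push Not at hsurj
    obtain ⟨z, hz⟩ := hsurj
    exact hf.colorable_of_not_surjective hconn (by omega) hG (by omega) hend hz

/-! ### Complete graphs recognised by their order -/

theorem IsRegularOfDegree.eq_top_iff {V : Type*} [Fintype V] [Nonempty V]
    {G : SimpleGraph V} [DecidableRel G.Adj] {d : ℕ} (hG : G.IsRegularOfDegree d) :
    G = ⊤ ↔ Fintype.card V = d + 1 := by
  classical
  constructor
  · rintro rfl
    have v := Classical.arbitrary V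
    have h := hG.degree_eq v
    rw [← card_neighborFinset_eq_degree] at h
    have h2 : (⊤ : SimpleGraph V).neighborFinset v = Finset.univ.erase v := by
      ext w
      simp [eq_comm]
    rw [h2, Finset.card_erase_of_mem (Finset.mem_univ v), Finset.card_univ] at h
    have := Fintype.card_pos (α := V)
    omega
  · intro hcard
    refine eq_top_iff_forall_ne_adj.2 fun u w huw => ?_
    have hsub : G.neighborFinset u ⊆ Finset.univ.erase u := fun x hx => by
      simpa using (G.ne_of_adj ((mem_neighborFinset _ _ _).1 hx)).symm
    have heq := Finset.eq_of_subset_of_card_le hsub (by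
      rw [Finset.card_erase_of_mem (Finset.mem_univ u), Finset.card_univ, hcard,
        card_neighborFinset_eq_degree, hG u]
      omega)
    rw [← mem_neighborFinset, heq]
    simpa using huw.symm

/-- Replaces isomorphism with `K₄` by a vertex count, which cospectral graphs share. -/
theorem IsRegularOfDegree.nonempty_iso_completeGraph_iff {V : Type*} [Fintype V] [Nonempty V]
    {G : SimpleGraph V} [DecidableRel G.Adj] {d : ℕ} (hG : G.IsRegularOfDegree d) :
    Nonempty (G ≃g completeGraph (Fin (d + 1))) ↔ Fintype.card V = d + 1 := by
  constructor
  · rintro ⟨e⟩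
    simpa using Fintype.card_congr e.toEquiv
  · intro h
    obtain rfl := hG.eq_top_iff.2 h
    exact ⟨Iso.completeGraph (Fintype.equivFinOfCardEq h)⟩

/-! ### Spectrum and bipartiteness -/

/-- Restates the eigenvalue equation vertex by vertex, the form in which a maximum principle
applies. -/
theorem mem_adjSpectrum_iff {V : Type*} [Fintype V] [DecidableEq V] (G : SimpleGraph V)
    [DecidableRel G.Adj] (a : ℝ) :
    a ∈ G.adjSpectrum ↔ ∃ x : V → ℝ, x ≠ 0 ∧ ∀ v, ∑ w ∈ G.neighborFinset v, x w = a * x v := by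
  have h1 : a ∈ G.adjSpectrum ↔ a ∈ spectrum ℝ (G.adjMatrix ℝ) := by
    rw [(G.isHermitian_adjMatrix ℝ).spectrum_real_eq_range_eigenvalues]
    simp [adjSpectrum]
  rw [h1, ← Matrix.spectrum_toLin', ← Module.End.hasEigenvalue_iff_mem_spectrum]
  constructor
  · intro h
    obtain ⟨x, hx⟩ := h.exists_hasEigenvector
    refine ⟨x, hx.2, fun v => ?_⟩
    have := congrFun hx.apply_eq_smul v
    rwa [Matrix.toLin'_apply, adjMatrix_mulVec_apply, Pi.smul_apply, smul_eq_mul] at this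
  · rintro ⟨x, hx, h⟩
    refine Module.End.hasEigenvalue_of_hasEigenvector (x := x) ⟨?_, hx⟩
    rw [Module.End.mem_eigenspace_iff]
    ext v
    rw [Matrix.toLin'_apply, adjMatrix_mulVec_apply, Pi.smul_apply, smul_eq_mul, h]

/-- A connected `d`-regular graph is bipartite iff `-d` is an eigenvalue. -/
theorem Connected.isBipartite_iff_neg_mem_adjSpectrum {V : Type*} [Fintype V] [DecidableEq V]
    {G : SimpleGraph V} [DecidableRel G.Adj] (hconn : G.Connected) {d : ℕ}
    (hG : G.IsRegularOfDegree d) : G.IsBipartite ↔ (-d : ℝ) ∈ G.adjSpectrum := by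
  have := hconn.nonempty
  rw [mem_adjSpectrum_iff]
  constructor
  · rintro ⟨c⟩
    -- The eigenvector is `1` on one colour class and `-1` on the other.
    refine ⟨fun v => if c v = 0 then 1 else -1, fun h => ?_, fun v => ?_⟩
    · have := congrFun h (Classical.arbitrary V)
      dsimp at this
      split_ifs at this <;> norm_num at this
    · rw [Finset.sum_congr rfl (g := fun _ => -(if c v = 0 then (1 : ℝ) else -1)),
        Finset.sum_const, card_neighborFinset_eq_degree, hG v, nsmul_eq_mul]
      · ring
      · intro w hw
        have := c.valid ((mem_neighborFinset _ _ _).1 hw)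
        by_cases h1 : c v = 0 <;> by_cases h2 : c w = 0
        · exact absurd (h1.trans h2.symm) this
        · simp [h1, h2]
        · simp [h1, h2]
        · omega
  · rintro ⟨x, hx0, hx⟩
    obtain ⟨m, hm⟩ := Finite.exists_max fun v => |x v|
    have hpos : 0 < |x m| := by
      obtain ⟨v, hv⟩ := Function.ne_iff.1 hx0
      exact (abs_pos.2 hv).trans_le (hm v)
    have key : ∀ v, |x v| = |x m| → ∀ w, G.Adj v w → x w = - x v := by
      intro v hv
      -- At a vertex of maximal modulus these summands are nonnegative, and the eigenvalue `-d`
      -- makes their sum `d|x v| - d|x v| = 0`; so each one vanishes.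
      have hsum : ∑ w ∈ G.neighborFinset v, (|x v| + SignType.sign (x v) * x w) = 0 := by
        rw [Finset.sum_add_distrib, Finset.sum_const, card_neighborFinset_eq_degree, hG v,
          nsmul_eq_mul, ← Finset.mul_sum, hx v, ← sign_mul_self (x v)]
        ring
      have hxv : x v ≠ 0 := by
        rw [← abs_pos, hv]
        exact hpos
      have hz := (Finset.sum_eq_zero_iff_of_nonneg fun w _ => ?_).1 hsum
      · intro w hw
        have := hz w (by simpa using hw)
        rcases hxv.lt_or_gt with h | h
        · simp [sign_neg h, abs_of_neg h] at this
          linarith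
        · simp [sign_pos h, abs_of_pos h] at this
          linarith
      · have h1 := hm w
        rw [← hv] at h1
        have := abs_le.1 h1
        rcases hxv.lt_or_gt with h | h
        · simp [sign_neg h]
          linarith
        · simp [sign_pos h]
          linarith
    have hall : ∀ v, |x v| = |x m| := by
      -- By `key`, the vertices of maximal modulus are closed under adjacency, hence exhaust the
      -- connected graph. The sign of `x` is then a 2-colouring.
      by_contra! h
      obtain ⟨z, hz⟩ := h
      obtain ⟨a, ha, b, hab, hb⟩ := hconn.exists_adj_boundary (U := {v | |x v| = |x m|}) (u := m)
        (w := z) rfl hz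
      exact hb (by rw [Set.mem_ofPred_eq, key a ha b hab, abs_neg]; exact ha)
    refine ⟨Coloring.mk (fun v => if 0 < x v then 0 else 1) fun {v w} hvw => ?_⟩
    have h1 := key v (hall v) w hvw
    have h2 : x v ≠ 0 := by
      rw [← abs_pos, hall v]
      exact hpos
    rcases h2.lt_or_gt with h | h
    · simp [h1, h, h.le]
    · simp [h1, h, h.le]

theorem Cospectral.card_eq {V W : Type*} [Fintype V] [DecidableEq V] [Fintype W] [DecidableEq W]
    {G : SimpleGraph V} [DecidableRel G.Adj] {H : SimpleGraph W} [DecidableRel H.Adj]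
    (h : G.Cospectral H) : Fintype.card V = Fintype.card W := by
  simpa [adjSpectrum] using congrArg Multiset.card h

/-! ### Values of the chromatic number -/

theorem Connected.chromaticNumber_eq_two_iff {V : Type*} [Fintype V] {G : SimpleGraph V}
    [DecidableRel G.Adj] (hconn : G.Connected) {d : ℕ} (hd : 0 < d) (hG : G.IsRegularOfDegree d) :
    G.chromaticNumber = 2 ↔ G.IsBipartite := by
  obtain ⟨v⟩ := hconn.nonempty
  obtain ⟨w, hw⟩ : (G.neighborFinset v).Nonempty := by
    rw [← Finset.card_pos, card_neighborFinset_eq_degree, hG v]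
    exact hd
  have h2 := two_le_chromaticNumber_of_adj ((mem_neighborFinset _ _ _).1 hw)
  rw [IsBipartite, ← chromaticNumber_le_iff_colorable]
  exact ⟨fun h => h.le, fun h => le_antisymm h h2⟩

theorem Connected.chromaticNumber_eq_of_card_eq_four {V : Type*} [Fintype V]
    {G : SimpleGraph V} [DecidableRel G.Adj] (hconn : G.Connected) (hG : G.IsRegularOfDegree 3)
    (h : Fintype.card V = 4) : G.chromaticNumber = 4 := by
  have := hconn.nonempty
  obtain rfl := hG.eq_top_iff.2 h
  rw [chromaticNumber_top, h]
  rfl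

theorem Connected.chromaticNumber_le_three {V : Type*} [Fintype V] [DecidableEq V]
    {G : SimpleGraph V} [DecidableRel G.Adj] (hconn : G.Connected) (hG : G.IsRegularOfDegree 3)
    (h : Fintype.card V ≠ 4) : G.chromaticNumber ≤ 3 := by
  have := hconn.nonempty
  exact (hconn.colorable_of_isRegularOfDegree le_rfl hG
    (fun ht => h (hG.eq_top_iff.1 ht))).chromaticNumber_le

theorem Connected.chromaticNumber_eq_three {V : Type*} [Fintype V] [DecidableEq V]
    {G : SimpleGraph V} [DecidableRel G.Adj] (hconn : G.Connected) (hG : G.IsRegularOfDegree 3)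
    (h : Fintype.card V ≠ 4) (hb : ¬ G.IsBipartite) : G.chromaticNumber = 3 := by
  refine le_antisymm (hconn.chromaticNumber_le_three hG h) ?_
  have h2 : ¬ G.chromaticNumber ≤ (2 : ℕ) := by rwa [chromaticNumber_le_iff_colorable]
  exact Order.add_one_le_of_lt (not_le.1 h2)

end SimpleGraph

theorem mainTheorem7 {V W : Type*} [Fintype V] [DecidableEq V] [Fintype W] [DecidableEq W]
    (G : SimpleGraph V) [DecidableRel G.Adj] (H : SimpleGraph W) [DecidableRel H.Adj]
    (hG : G.Connected) (hG3 : G.IsRegularOfDegree 3)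
    (hH : H.Connected) (hH3 : H.IsRegularOfDegree 3) :
    (G.chromaticNumber ≤ 4 ∧
      (G.chromaticNumber = 4 ↔ Nonempty (G ≃g SimpleGraph.completeGraph (Fin 4))) ∧
      (G.chromaticNumber = 2 ↔ G.IsBipartite)) ∧
    (G.Cospectral H →
      G.chromaticNumber = H.chromaticNumber ∧
      (G.IsBipartite ↔ H.IsBipartite) ∧
      (Nonempty (G ≃g SimpleGraph.completeGraph (Fin 4)) ↔
        Nonempty (H ≃g SimpleGraph.completeGraph (Fin 4)))) := by
  have := hG.nonempty
  have := hH.nonempty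
  rw [hG3.nonempty_iso_completeGraph_iff, hH3.nonempty_iso_completeGraph_iff]
  have h2G := hG.chromaticNumber_eq_two_iff (by omega) hG3
  have h2H := hH.chromaticNumber_eq_two_iff (by omega) hH3
  refine ⟨⟨?_, ⟨fun h => ?_, hG.chromaticNumber_eq_of_card_eq_four hG3⟩, h2G⟩, fun hcosp => ?_⟩
  · by_cases h : Fintype.card V = 4
    · exact (hG.chromaticNumber_eq_of_card_eq_four hG3 h).le
    · exact (hG.chromaticNumber_le_three hG3 h).trans (by norm_num)
  · by_contra hne
    have := hG.chromaticNumber_le_three hG3 hne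
    rw [h] at this
    exact absurd this (by norm_num)
  · have hb : G.IsBipartite ↔ H.IsBipartite := by
      rw [hG.isBipartite_iff_neg_mem_adjSpectrum hG3, hH.isBipartite_iff_neg_mem_adjSpectrum hH3,
        show G.adjSpectrum = H.adjSpectrum from hcosp]
    have hcard := hcosp.card_eq
    refine ⟨?_, hb, by rw [hcard]⟩
    -- The values 4, 2 and 3 are separated by order and bipartiteness, which `G` and `H` share.
    by_cases h4 : Fintype.card V = 4
    · rw [hG.chromaticNumber_eq_of_card_eq_four hG3 h4,
        hH.chromaticNumber_eq_of_card_eq_four hH3 (hcard ▸ h4)]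
    by_cases hGb : G.IsBipartite
    · rw [h2G.2 hGb, h2H.2 (hb.1 hGb)]
    · rw [hG.chromaticNumber_eq_three hG3 h4 hGb,
        hH.chromaticNumber_eq_three hH3 (hcard ▸ h4) (hb.not.1 hGb)]
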